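/- **Setting.** Formulae of $\mathbf{CommACT}_\omega$ are built from countably many variables and the constants $\mathbf 0,\mathbf 1$ using the binary connectives $\multimap,\cdot,\vee,\wedge$ and the unary connective $^*$. A sequent $\Gamma\vdash C$ consists of a finite multiset $\Gamma$ of formulae and a formula $C$. The derivable sequents form the smallest set containing the axioms $$A\vdash A,\qquad \Gamma,\mathbf 0\vdash C,\qquad \vdash\mathbf 1$$ and closed under the following rules (premises $\Rightarrow$ conclusion): - $\mathbf 1L$: $\ \Gamma\vdash C\ \Rightarrow\ \Gamma,\mathbf 1\vdash C$; - $\multimap L$: $\ \Pi\vdash A$ and $\Gamma,B\vdash C\ \Rightarrow\ \Gamma,\Pi,A\multimap B\vdash C$; $\quad\multimap R$: $\ A,\Pi\vdash B\ \Rightarrow\ \Pi\vdash A\multimap B$; - $\cdot L$: $\ \Gamma,A,B\vdash C\ \Rightarrow\ \Gamma,A\cdot B\vdash C$; $\quad\cdot R$: $\ \Pi\vdash A$ and $\Delta\vdash B\ \Rightarrow\ \Pi,\Delta\vdash A\cdot B$; - $\vee L$: $\ \Gamma,A\vdash C$ and $\Gamma,B\vdash C\ \Rightarrow\ \Gamma,A\vee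 B\vdash C$; $\quad\vee R$: $\ \Pi\vdash A_i\ \Rightarrow\ \Pi\vdash A_1\vee A_2$ ($i=1,2$); - $\wedge L$: $\ \Gamma,A_i\vdash C\ \Rightarrow\ \Gamma,A_1\wedge A_2\vdash C$ ($i=1,2$); $\quad\wedge R$: $\ \Pi\vdash A$ and $\Pi\vdash B\ \Rightarrow\ \Pi\vdash A\wedge B$; - ${*}L_\omega$: $\ \Gamma,A^n\vdash C$ for all $n\ge 0\ \Rightarrow\ \Gamma,A^*\vdash C$; $\quad{*}R_n$ ($n\ge0$): $\ \Pi_1\vdash A,\dots,\Pi_n\vdash A\ \Rightarrow\ \Pi_1,\dots,\Pi_n\vdash A^*$; - Cut: $\ \Pi\vdash A$ and $\Gamma,A\vdash C\ \Rightarrow\ \Gamma,\Pi\vdash C$. Here $A^n$ in an antecedent means $n$ copies of $A$. A deterministic 3-counter machine $\mathcal M$ has a finite set $Q$ of states, an initial state $q_S$, a final state $q_F$, registers $\mathsf a,\mathsf b,\mathsf c$ with values in $\mathbb N$, and a finite set of instructions of two forms: $\mathrm{inc}(p,r,q)$ (in state $p$, increase $r$ by 1 and go to state $q$) and $\mathrm{jzdec}(p,r,q_0,q_1)$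 (in state $p$, if $r=0$ go to $q_0$, otherwise decrease $r$ by 1 and go to $q_1$). For each state $p$ there is at most one instruction whose first parameter is $p$, and $q_F$ is the unique state without an instruction. On input $x\in\mathbb N$ the machine starts in state $q_S$ with $\mathsf a=x$, $\mathsf b=\mathsf c=0$; it runs forever on $x$ if there is an infinite sequence of computation steps from this configuration. Choose pairwise distinct variables for the states $q\in Q$, for $\mathsf a,\mathsf b,\mathsf c$, and for $z_{\mathsf a},z_{\mathsf b},z_{\mathsf c}$. Put $N_r=z_r\multimap z_r$ and $$A_{\mathrm{inc}(p,r,q)}=p\multimap(q\cdot r),\qquad A_{\mathrm{jzdec}(p,r,q_0,q_1)}=\bigl((p\cdot r)\multimap q_1\bigr)\wedge\bigl(p\multimap(q_0\vee z_r)\bigr),$$ $$E=N_{\mathsf a}\wedge N_{\mathsf b}\wedge N_{\mathsf c}\wedge\bigwedge_{I}A_I\quad(I\text{ ranging over the instructions of }\mathcal M),$$ $$D=\Bigl(\mathsf a^*\cdot\mathsf b^*\cdot\mathsf c^*\cdot\bigvee_{q\in Q}q\Bigr)\vee(\mathsf b^*\cdot\mathsf c^*\cdot z_{\mathsf a})\vee(\mathsf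 a^*\cdot\mathsf c^*\cdot z_{\mathsf b})\vee(\mathsf a^*\cdot\mathsf b^*\cdot z_{\mathsf c}).$$ **Theorem.** For every deterministic 3-counter machine $\mathcal M$ and every $x\in\mathbb N$, $\mathcal M$ runs forever on input $x$ if and only if the sequent $E^*,q_S,\mathsf a^x\vdash D$ is derivable in $\mathbf{CommACT}_\omega$. Moreover, the derivability problem for $\mathbf{CommACT}_\omega$ is $\Pi^0_1$-hard: for every set $S\subseteq\mathbb N$ with recursively enumerable complement there is a computable function $f$ from $\mathbb N$ to sequents such that, for all $n\in\mathbb N$, $n\in S$ if and only if $f(n)$ is derivable. -/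

import Mathlib

namespace CommACT

/-- Formulae of infinitary commutative action logic; the variables are indexed by `ℕ`. -/
inductive Formula : Type
  | var (n : ℕ)
  | zero
  | one
  | imp (A B : Formula)
  | mul (A B : Formula)
  | or (A B : Formula)
  | and (A B : Formula)
  | star (A : Formula)

/-- Derivability of the sequent `Γ ⊢ C` (`Γ` a multiset of formulae): the smallest set of sequents
that contains the axioms and is closed under the rules, including the `ω`-rule `starL` and cut. -/
inductive Derivable : Multiset Formula → Formula → Prop
  | id (A : Formula) : Derivable {A} A
  | zeroL (Γ : Multiset Formula) (C : Formula) : Derivable (Γ + {Formula.zero}) C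
  | oneL {Γ : Multiset Formula} {C : Formula} :
      Derivable Γ C → Derivable (Γ + {Formula.one}) C
  | oneR : Derivable 0 Formula.one
  | impL {Γ P : Multiset Formula} {A B C : Formula} :
      Derivable P A → Derivable (Γ + {B}) C → Derivable (Γ + P + {Formula.imp A B}) C
  | impR {P : Multiset Formula} {A B : Formula} :
      Derivable ({A} + P) B → Derivable P (Formula.imp A B)
  | mulL {Γ : Multiset Formula} {A B C : Formula} :
      Derivable (Γ + {A} + {B}) C → Derivable (Γ + {Formula.mul A B}) C
  | mulR {P Δ : Multiset Formula} {A B : Formula} :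
      Derivable P A → Derivable Δ B → Derivable (P + Δ) (Formula.mul A B)
  | orL {Γ : Multiset Formula} {A B C : Formula} :
      Derivable (Γ + {A}) C → Derivable (Γ + {B}) C → Derivable (Γ + {Formula.or A B}) C
  | orR₁ {P : Multiset Formula} {A B : Formula} :
      Derivable P A → Derivable P (Formula.or A B)
  | orR₂ {P : Multiset Formula} {A B : Formula} :
      Derivable P B → Derivable P (Formula.or A B)
  | andL₁ {Γ : Multiset Formula} {A B C : Formula} :
      Derivable (Γ + {A}) C → Derivable (Γ + {Formula.and A B}) C
  | andL₂ {Γ : Multiset Formula} {A B C : Formula} :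
      Derivable (Γ + {B}) C → Derivable (Γ + {Formula.and A B}) C
  | andR {P : Multiset Formula} {A B : Formula} :
      Derivable P A → Derivable P B → Derivable P (Formula.and A B)
  | starL {Γ : Multiset Formula} {A C : Formula} :
      (∀ n : ℕ, Derivable (Γ + Multiset.replicate n A) C) → Derivable (Γ + {Formula.star A}) C
  | starR {A : Formula} (n : ℕ) (P : Fin n → Multiset Formula) :
      (∀ i, Derivable (P i) A) → Derivable (∑ i, P i) (Formula.star A)
  | cut {Γ P : Multiset Formula} {A C : Formula} :
      Derivable P A → Derivable (Γ + {A}) C → Derivable (Γ + P) C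

/-! ### Gödel numbering of formulae -/

/-- An explicit Gödel numbering of formulae. -/
def Formula.toNat : Formula → ℕ
  | .zero => 0
  | .one => 1
  | .var n => 6 * n + 2
  | .imp A B => 6 * Nat.pair A.toNat B.toNat + 3
  | .mul A B => 6 * Nat.pair A.toNat B.toNat + 4
  | .or A B => 6 * Nat.pair A.toNat B.toNat + 5
  | .and A B => 6 * Nat.pair A.toNat B.toNat + 6
  | .star A => 6 * A.toNat + 7

/-- The formula with a given Gödel number. -/
def Formula.ofNat : ℕ → Formula
  | 0 => .zero
  | 1 => .one
  | n + 2 =>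
    have h : n / 6 < n + 2 := by omega
    have h₁ : (n / 6).unpair.1 < n + 2 := lt_of_le_of_lt (Nat.unpair_left_le _) h
    have h₂ : (n / 6).unpair.2 < n + 2 := lt_of_le_of_lt (Nat.unpair_right_le _) h
    match n % 6 with
    | 0 => .var (n / 6)
    | 1 => .imp (Formula.ofNat (n / 6).unpair.1) (Formula.ofNat (n / 6).unpair.2)
    | 2 => .mul (Formula.ofNat (n / 6).unpair.1) (Formula.ofNat (n / 6).unpair.2)
    | 3 => .or (Formula.ofNat (n / 6).unpair.1) (Formula.ofNat (n / 6).unpair.2)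
    | 4 => .and (Formula.ofNat (n / 6).unpair.1) (Formula.ofNat (n / 6).unpair.2)
    | _ => .star (Formula.ofNat (n / 6))

theorem Formula.ofNat_toNat (A : Formula) : Formula.ofNat A.toNat = A := by
  have d (m r : ℕ) (hr : r < 6) : (6 * m + r) / 6 = m := by omega
  have e (m r : ℕ) (hr : r < 6) : (6 * m + r) % 6 = r := by omega
  induction A with
  | zero => simp [Formula.toNat, Formula.ofNat]
  | one => simp [Formula.toNat, Formula.ofNat]
  | var n => simp [Formula.toNat, Formula.ofNat]
  | imp A B hA hB =>
    simp [Formula.toNat, Formula.ofNat, d _ 1, e _ 1, hA, hB]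
  | mul A B hA hB =>
    simp [Formula.toNat, Formula.ofNat, d _ 2, e _ 2, hA, hB]
  | or A B hA hB =>
    simp [Formula.toNat, Formula.ofNat, d _ 3, e _ 3, hA, hB]
  | and A B hA hB =>
    simp [Formula.toNat, Formula.ofNat, d _ 4, e _ 4, hA, hB]
  | star A hA =>
    simp [Formula.toNat, Formula.ofNat, d _ 5, e _ 5, hA]

theorem Formula.toNat_ofNat (n : ℕ) : (Formula.ofNat n).toNat = n := by
  induction n using Nat.strong_induction_on with
  | _ n ih =>
    match n with
    | 0 => simp [Formula.toNat, Formula.ofNat]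
    | 1 => simp [Formula.toNat, Formula.ofNat]
    | n + 2 =>
      have h : n / 6 < n + 2 := by omega
      have h₁ := ih _ (lt_of_le_of_lt (Nat.unpair_left_le _) h)
      have h₂ := ih _ (lt_of_le_of_lt (Nat.unpair_right_le _) h)
      have h₃ := ih _ h
      rw [Formula.ofNat]
      have h₆ : n % 6 < 6 := Nat.mod_lt _ (by norm_num)
      have hd := Nat.div_add_mod n 6
      generalize hr : n % 6 = r at h₆ hd ⊢
      interval_cases r <;> simp only [Formula.toNat, h₁, h₂, h₃, Nat.pair_unpair] <;> omega

/-- The Gödel numbering is a bijection. -/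
def Formula.equivNat : Formula ≃ ℕ where
  toFun := Formula.toNat
  invFun := Formula.ofNat
  left_inv := Formula.ofNat_toNat
  right_inv := Formula.toNat_ofNat

instance : Primcodable Formula := Primcodable.ofEquiv ℕ Formula.equivNat

/-- A predicate is `Π₁⁰`-hard if every `Π₁⁰` set of natural numbers (a set with recursively
enumerable complement) is many-one reducible to it by a computable function. -/
def Pi01Hard {α : Type} [Primcodable α] (P : α → Prop) : Prop :=
  ∀ S : ℕ → Prop, REPred (fun n => ¬ S n) → S ≤₀ P

/-- The derivability problem: a sequent is given by a list of its antecedents and its succedent,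
and the order of the list is immaterial. -/
def DerivabilityProblem (s : List Formula × Formula) : Prop :=
  Derivable (s.1 : Multiset Formula) s.2

/-! ### Counter machines -/

/-- The three registers. -/
inductive Register : Type
  | a
  | b
  | c
  deriving DecidableEq

/-- Instructions of counter machines with set of states `Q`. -/
inductive Instruction (Q : Type*)
  | inc (p : Q) (r : Register) (q : Q)
  | jzdec (p : Q) (r : Register) (q₀ q₁ : Q)

/-- The state in which an instruction is applied. -/
def Instruction.source {Q : Type*} : Instruction Q → Q
  | .inc p _ _ => p
  | .jzdec p _ _ _ => p

/-- Deterministic 3-counter machines with set of states `Q`. -/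
structure Machine (Q : Type*) where
  /-- An enumeration of the (finite) set of states. -/
  states : List Q
  mem_states : ∀ q, q ∈ states
  /-- The (finite) set of instructions, listed in some order. -/
  instructions : List (Instruction Q)
  /-- The initial state. -/
  start : Q
  /-- The final state. -/
  final : Q
  deterministic : ∀ I ∈ instructions, ∀ J ∈ instructions, I.source = J.source → I = J
  /-- The final state is the only one without an instruction. -/
  eq_final_iff : ∀ q, q = final ↔ ∀ I ∈ instructions, I.source ≠ q

/-- Configurations: a state and the values of the registers. -/
structure Config (Q : Type*) where
  state : Q
  val : Register → ℕ

/-- One step of computation. -/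
inductive Machine.Step {Q : Type*} (M : Machine Q) : Config Q → Config Q → Prop
  | inc {p q : Q} {r : Register} (v : Register → ℕ) :
      Instruction.inc p r q ∈ M.instructions →
      M.Step ⟨p, v⟩ ⟨q, Function.update v r (v r + 1)⟩
  | jz {p q₀ q₁ : Q} {r : Register} (v : Register → ℕ) :
      Instruction.jzdec p r q₀ q₁ ∈ M.instructions → v r = 0 →
      M.Step ⟨p, v⟩ ⟨q₀, v⟩
  | dec {p q₀ q₁ : Q} {r : Register} (v : Register → ℕ) :
      Instruction.jzdec p r q₀ q₁ ∈ M.instructions → v r ≠ 0 →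
      M.Step ⟨p, v⟩ ⟨q₁, Function.update v r (v r - 1)⟩

/-- The starting configuration on input `x`: the input is in register `a`. -/
def Machine.init {Q : Type*} (M : Machine Q) (x : ℕ) : Config Q :=
  ⟨M.start, fun r => if r = Register.a then x else 0⟩

/-- The machine runs forever on input `x`: there is an infinite computation from the starting
configuration. -/
def Machine.RunsForever {Q : Type*} (M : Machine Q) (x : ℕ) : Prop :=
  ∃ c : ℕ → Config Q, c 0 = M.init x ∧ ∀ n, M.Step (c n) (c (n + 1))

/-! ### Encoding of machines -/

/-- The symbols that are represented by variables: states `q`, counters `a`, `b`, `c`, and the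
zero-test symbols `z_a`, `z_b`, `z_c`. -/
inductive Symb (Q : Type*)
  | state (q : Q)
  | counter (r : Register)
  | ztest (r : Register)

/-- Conjunction of a nonempty list of formulae. -/
def bigAnd (A : Formula) : List Formula → Formula
  | [] => A
  | B :: l => .and A (bigAnd B l)

/-- Disjunction of a list of formulae (`0` for the empty list, which does not occur below). -/
def bigOr : List Formula → Formula
  | [] => .zero
  | [A] => A
  | A :: B :: l => .or A (bigOr (B :: l))

section Encoding

variable {Q : Type*} (ν : Symb Q → ℕ)

/-- The variable of a state. -/
def stateVar (q : Q) : Formula := .var (ν (.state q))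

/-- The variable of a counter. -/
def counterVar (r : Register) : Formula := .var (ν (.counter r))

/-- The variable `z_r`. -/
def zVar (r : Register) : Formula := .var (ν (.ztest r))

/-- The formula `A_I` that encodes the instruction `I`. -/
def instrFormula : Instruction Q → Formula
  | .inc p r q => .imp (stateVar ν p) (.mul (stateVar ν q) (counterVar ν r))
  | .jzdec p r q₀ q₁ =>
    .and (.imp (.mul (stateVar ν p) (counterVar ν r)) (stateVar ν q₁))
      (.imp (stateVar ν p) (.or (stateVar ν q₀) (zVar ν r)))

/-- The dummy instruction `N_r`. -/
def dummy (r : Register) : Formula := .imp (zVar ν r) (zVar ν r)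

/-- The formula `E = N_a ∧ N_b ∧ N_c ∧ ⋀ A_I`. -/
def formulaE (M : Machine Q) : Formula :=
  bigAnd (dummy ν .a) (dummy ν .b :: dummy ν .c :: M.instructions.map (instrFormula ν))

/-- The formula `D = (a* b* c* ⋁ q) ∨ (b* c* z_a) ∨ (a* c* z_b) ∨ (a* b* z_c)`. -/
def formulaD (M : Machine Q) : Formula :=
  let a := Formula.star (counterVar ν .a)
  let b := Formula.star (counterVar ν .b)
  let c := Formula.star (counterVar ν .c)
  .or (.mul a (.mul b (.mul c (bigOr (M.states.map (stateVar ν))))))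
    (.or (.mul b (.mul c (zVar ν .a)))
      (.or (.mul a (.mul c (zVar ν .b)))
        (.mul a (.mul b (zVar ν .c)))))

end Encoding

end CommACT

/-! Forever to derivable: the ω-rule reduces the sequent to its instances with `n` copies of `E`,
proved by induction on `n`. Each copy of `E` is spent on the instruction that performs the next
step, and `D` accepts any configuration once the copies are used up. A zero test is carried out by
`∨L`: one branch continues in `q₀`, the other holds `z_r`, burns its remaining copies of `E` as
`N_r`, and meets a disjunct of `D` without `r`, which fits because `r` is empty.

Derivable to forever: no cut elimination is needed, since phase semantics is sound for all rules,
cut and the ω-rule included (`Phase.sound`). In the chosen model an element counts copies of `E` and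
records states, counters and zero-test symbols. The pole holds the elements with one state, no test
symbol, and a computation of at least as many steps as there are copies of `E`, together with those
with no state, one symbol `z_r` and no `r`. Then `D` lies in the pole (`sem_formulaD_subset`) and
one copy of `E` lies in `E` (`sem_formulaE`), so a derivation yields computations of every length
`n`. Determinism glues these into an infinite one (`Machine.runsForever_iff`).

Hardness: a recursively enumerable complement is the halting domain of a `ToPartrec.Code`, hence of
a Turing machine with finitely many accessible states, which a 3-counter machine simulates by
storing each half of the tape as a number (`TMSim.machine_runsForever_iff`). The machine, `E` and
`D` depend only on the set; the input fixes just the number of copies of `a`, a primitive recursive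
function of it (`primrec_code_trInit`). -/

namespace CommACT

open scoped Pointwise

/-! ### Phase semantics -/

namespace Phase

variable {M : Type*} [AddCommMonoid M] (B : Set M)

/-- The closure operator of the phase space with pole `B`. -/
def cl (X : Set M) : Set M := {m | ∀ y, (∀ x ∈ X, x + y ∈ B) → m + y ∈ B}

theorem subset_cl (X : Set M) : X ⊆ cl B X := fun _ hx _ hy => hy _ hx

theorem cl_mono {X Y : Set M} (h : X ⊆ Y) : cl B X ⊆ cl B Y :=
  fun _ hm y hy => hm y fun x hx => hy x (h hx)

theorem cl_idem (X : Set M) : cl B (cl B X) ⊆ cl B X :=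
  fun _ hm y hy => hm y fun _ hx => hx y hy

theorem cl_pole : cl B B ⊆ B := fun m hm => by
  -- Membership in the pole is the test against the neutral element.
  simpa using hm 0 (by simp)

/-- A test `y` for `g + m` is the test `g + y` for `m`. This stability of the closure under
translation is what makes every left rule sound: a closed antecedent formula may be replaced by its
generators. -/
theorem add_mem_cl {X Y : Set M} {g : M} (h : ∀ x ∈ X, g + x ∈ cl B Y) {m : M} (hm : m ∈ cl B X) :
    g + m ∈ cl B Y := fun y hy => by
  have := hm (g + y) fun x hx => by
    have := h x hx y hy
    rwa [← add_assoc, add_comm x g]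
  rwa [← add_assoc, add_comm m g] at this

theorem cl_subset_cl {X Y : Set M} (h : X ⊆ cl B Y) : cl B X ⊆ cl B Y :=
  (cl_mono B h).trans (cl_idem B Y)

theorem cl_add_cl_subset (X Y : Set M) : cl B X + cl B Y ⊆ cl B (X + Y) := by
  rintro _ ⟨x, hx, y, hy, rfl⟩
  refine add_mem_cl B (fun y hy => ?_) hy
  rw [add_comm x y]
  refine add_mem_cl B (fun z hz => subset_cl B _ ?_) hx
  rw [add_comm]
  exact ⟨y, hy, z, hz, rfl⟩

theorem cl_cl_add_cl (X Y : Set M) : cl B (cl B X + cl B Y) = cl B (X + Y) :=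
  (cl_subset_cl B (cl_add_cl_subset B X Y)).antisymm
    (cl_mono B (Set.add_subset_add (subset_cl B X) (subset_cl B Y)))

theorem cl_cl_union_cl (X Y : Set M) : cl B (cl B X ∪ cl B Y) = cl B (X ∪ Y) :=
  (cl_subset_cl B (Set.union_subset (cl_mono B Set.subset_union_left)
    (cl_mono B Set.subset_union_right))).antisymm
    (cl_mono B (Set.union_subset_union (subset_cl B X) (subset_cl B Y)))

theorem nsmul_cl_subset (n : ℕ) (X : Set M) : n • cl B X ⊆ cl B (n • X) := by
  induction n with
  | zero => simpa only [zero_smul] using subset_cl B 0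
  | succ n ih =>
    rw [succ_nsmul, succ_nsmul]
    refine (Set.add_subset_add_right ih).trans ?_
    exact cl_add_cl_subset B _ _

theorem cl_iUnion_nsmul_cl (X : Set M) :
    cl B (⋃ n : ℕ, n • cl B X) = cl B (⋃ n : ℕ, n • X) :=
  (cl_subset_cl B (Set.iUnion_subset fun n => (nsmul_cl_subset B n X).trans
    (cl_mono B (Set.subset_iUnion (fun n : ℕ => n • X) n)))).antisymm
    (cl_mono B (Set.iUnion_mono fun _ => Set.nsmul_subset_nsmul_left (subset_cl B X)))

/-- The interpretation of formulae in the phase space with pole `B`. -/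
def sem (val : ℕ → Set M) : Formula → Set M
  | .var n => cl B (val n)
  | .zero => cl B ∅
  | .one => cl B {0}
  | .imp A C => {m | ∀ x ∈ sem val A, m + x ∈ sem val C}
  | .mul A C => cl B (sem val A + sem val C)
  | .or A C => cl B (sem val A ∪ sem val C)
  | .and A C => sem val A ∩ sem val C
  | .star A => cl B (⋃ n : ℕ, n • sem val A)

variable (val : ℕ → Set M)

theorem cl_sem (A : Formula) : cl B (sem B val A) = sem B val A := by
  refine Set.Subset.antisymm ?_ (subset_cl B _)
  induction A with
  | var | zero | one | mul | or | star => exact cl_idem B _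
  | imp A C _ hC =>
    intro m hm x hx
    rw [add_comm]
    refine hC (add_mem_cl B (fun y hy => subset_cl B _ ?_) hm)
    rw [add_comm]
    exact hy x hx
  | and A C hA hC =>
    exact fun m hm => ⟨hA (cl_mono B Set.inter_subset_left hm),
      hC (cl_mono B Set.inter_subset_right hm)⟩

/-- The interpretation of the antecedent of a sequent. -/
def ctx (Γ : Multiset Formula) : Set M := (Γ.map (sem B val)).sum

theorem ctx_add (Γ Δ : Multiset Formula) : ctx B val (Γ + Δ) = ctx B val Γ + ctx B val Δ := by
  simp [ctx]

theorem ctx_singleton (A : Formula) : ctx B val {A} = sem B val A := by simp [ctx]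

theorem ctx_zero : ctx B val 0 = {0} := by simp [ctx, Set.singleton_zero]

theorem ctx_replicate (n : ℕ) (A : Formula) :
    ctx B val (Multiset.replicate n A) = n • sem B val A := by
  simp [ctx]

theorem ctx_sum {n : ℕ} (P : Fin n → Multiset Formula) :
    ctx B val (∑ i, P i) = ∑ i, ctx B val (P i) := by
  let f : Multiset Formula →+ Set M :=
    { toFun := ctx B val, map_zero' := by simp [ctx], map_add' := ctx_add B val }
  exact map_sum f P Finset.univ

theorem add_cl_subset {G X : Set M} {C : Formula} (h : G + X ⊆ sem B val C) :
    G + cl B X ⊆ sem B val C := by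
  rintro _ ⟨g, hg, m, hm, rfl⟩
  rw [← cl_sem]
  exact add_mem_cl B (fun x hx => subset_cl B _ (h ⟨g, hg, x, hx, rfl⟩)) hm

theorem sound {Γ : Multiset Formula} {C : Formula} (h : Derivable Γ C) :
    ctx B val Γ ⊆ sem B val C := by
  induction h with
  | id A => rw [ctx_singleton]
  | zeroL Γ C =>
    rw [ctx_add, ctx_singleton]
    exact add_cl_subset B val (by simp)
  | oneL _ ih =>
    rw [ctx_add, ctx_singleton]
    exact add_cl_subset B val (by simpa using ih)
  | oneR =>
    rw [ctx_zero]
    exact subset_cl B _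
  | impL _ _ ih₁ ih₂ =>
    rw [ctx_add, ctx_singleton] at ih₂
    rw [ctx_add, ctx_add, ctx_singleton]
    rintro _ ⟨_, ⟨g, hg, p, hp, rfl⟩, m, hm, rfl⟩
    have := ih₂ ⟨g, hg, m + p, hm p (ih₁ hp), rfl⟩
    simpa [add_assoc, add_comm p m] using this
  | impR _ ih =>
    intro p hp x hx
    rw [ctx_add, ctx_singleton] at ih
    rw [add_comm]
    exact ih ⟨x, hx, p, hp, rfl⟩
  | mulL _ ih =>
    rw [ctx_add, ctx_singleton]
    refine add_cl_subset B val ?_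
    rwa [ctx_add, ctx_add, ctx_singleton, ctx_singleton, add_assoc] at ih
  | mulR _ _ ih₁ ih₂ =>
    rw [ctx_add]
    exact (Set.add_subset_add ih₁ ih₂).trans (subset_cl B _)
  | orL _ _ ih₁ ih₂ =>
    rw [ctx_add, ctx_singleton] at ih₁ ih₂ ⊢
    refine add_cl_subset B val ?_
    rw [Set.add_union]
    exact Set.union_subset ih₁ ih₂
  | orR₁ _ ih => exact (ih.trans Set.subset_union_left).trans (subset_cl B _)
  | orR₂ _ ih => exact (ih.trans Set.subset_union_right).trans (subset_cl B _)
  | andL₁ _ ih =>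
    rw [ctx_add, ctx_singleton] at ih ⊢
    exact (Set.add_subset_add_left Set.inter_subset_left).trans ih
  | andL₂ _ ih =>
    rw [ctx_add, ctx_singleton] at ih ⊢
    exact (Set.add_subset_add_left Set.inter_subset_right).trans ih
  | andR _ _ ih₁ ih₂ => exact Set.subset_inter ih₁ ih₂
  | starL _ ih =>
    rw [ctx_add, ctx_singleton]
    refine add_cl_subset B val ?_
    rw [Set.add_iUnion]
    refine Set.iUnion_subset fun n => ?_
    have := ih n
    rwa [ctx_add, ctx_replicate] at this
  | starR n P _ ih =>
    rw [ctx_sum]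
    refine Set.Subset.trans ?_ (subset_cl B _)
    refine Set.Subset.trans ?_ (Set.subset_iUnion _ n)
    refine (Set.finsetSum_subset_finsetSum _ _ _ fun i _ => ih i).trans ?_
    simp
  | cut _ _ ih₁ ih₂ =>
    rw [ctx_add, ctx_singleton] at ih₂
    rw [ctx_add]
    exact (Set.add_subset_add_left ih₁).trans ih₂

end Phase

/-! ### Computations of counter machines -/

variable {Q : Type*} {M : Machine Q}

/-- There is a computation of `n` steps from a configuration. -/
def Machine.Runs (M : Machine Q) : ℕ → Config Q → Prop
  | 0, _ => True
  | n + 1, c => ∃ c', M.Step c c' ∧ M.Runs n c'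

theorem Machine.Step.unique {c c₁ c₂ : Config Q} (h₁ : M.Step c c₁) (h₂ : M.Step c c₂) :
    c₁ = c₂ := by
  cases h₁ with
  | inc v h =>
    cases h₂ with
    | inc _ h' => cases M.deterministic _ h _ h' rfl; rfl
    | jz _ h' => cases M.deterministic _ h _ h' rfl
    | dec _ h' => cases M.deterministic _ h _ h' rfl
  | jz v h hv =>
    cases h₂ with
    | inc _ h' => cases M.deterministic _ h _ h' rfl
    | jz _ h' => cases M.deterministic _ h _ h' rfl; rfl
    | dec _ h' hv' => cases M.deterministic _ h _ h' rfl; exact absurd hv hv'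
  | dec v h hv =>
    cases h₂ with
    | inc _ h' => cases M.deterministic _ h _ h' rfl
    | jz _ h' hv' => cases M.deterministic _ h _ h' rfl; exact absurd hv' hv
    | dec _ h' => cases M.deterministic _ h _ h' rfl; rfl

/-- The successor is unique, so the runs of all lengths from a configuration share their first step,
and the successor again has runs of all lengths. Iterating gives the infinite computation. -/
theorem Machine.runsForever_iff (x : ℕ) : M.RunsForever x ↔ ∀ n, M.Runs n (M.init x) := by
  constructor
  · rintro ⟨c, h0, h⟩ n
    have key : ∀ n i, M.Runs n (c i) := by
      intro n
      induction n with
      | zero => exact fun _ => trivial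
      | succ n ih => exact fun i => ⟨_, h i, ih _⟩
    exact h0 ▸ key n 0
  · intro h
    have next (c : {c : Config Q // ∀ n, M.Runs n c}) :
        ∃ c' : {c : Config Q // ∀ n, M.Runs n c}, M.Step c c' := by
      obtain ⟨c, hc⟩ := c
      obtain ⟨c', hs, -⟩ := hc 1
      refine ⟨⟨c', fun n => ?_⟩, hs⟩
      obtain ⟨c'', hs', hr⟩ := hc (n + 1)
      rwa [hs.unique hs']
    choose f hf using next
    refine ⟨fun n => (f^[n] ⟨_, h⟩).1, rfl, fun n => ?_⟩
    simp only [Function.iterate_succ_apply']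
    exact hf _

/-! ### From derivations to computations -/

section Model

/-- The monoid of the model: number of copies of `E`, states, counters, zero-test symbols. -/
abbrev Space (Q : Type*) : Type _ := ℕ × Multiset Q × (Register → ℕ) × Multiset Register

/-- The pole of the model. -/
def pole (M : Machine Q) : Set (Space Q) :=
  {m | (∃ q, m.2.1 = {q} ∧ m.2.2.2 = 0 ∧ M.Runs m.1 ⟨q, m.2.2.1⟩) ∨
    (m.2.1 = 0 ∧ ∃ r, m.2.2.2 = {r} ∧ m.2.2.1 r = 0)}

/-- The element of the model that represents a symbol. -/
def symbElem : Symb Q → Space Q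
  | .state q => (0, {q}, 0, 0)
  | .counter r => (0, 0, Pi.single r 1, 0)
  | .ztest r => (0, 0, 0, {r})

/-- The valuation of the variables in the model. -/
def valuation (ν : Symb Q → ℕ) (n : ℕ) : Set (Space Q) := {m | ∃ s, ν s = n ∧ m = symbElem s}

variable {ν : Symb Q → ℕ}

theorem sem_symb (hν : Function.Injective ν) (s : Symb Q) :
    Phase.sem (pole M) (valuation ν) (.var (ν s)) = Phase.cl (pole M) {symbElem s} := by
  have : valuation ν (ν s) = {symbElem s} := by
    ext m
    simp [valuation, hν.eq_iff]
  rw [Phase.sem, this]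

/-- Since the meaning of `C` is closed, an implication need only be checked on generators of the
premise, against contexts `y` that send every generator of the conclusion into the pole. -/
theorem sem_imp {X Y : Set (Space Q)} {A C : Formula} {e : Space Q}
    (hA : Phase.sem (pole M) (valuation ν) A = Phase.cl (pole M) X)
    (hC : Phase.sem (pole M) (valuation ν) C = Phase.cl (pole M) Y)
    (h : ∀ x ∈ X, ∀ y, (∀ z ∈ Y, z + y ∈ pole M) → e + x + y ∈ pole M) :
    e ∈ Phase.sem (pole M) (valuation ν) (.imp A C) := by
  intro x hx
  rw [hA] at hx
  rw [hC]
  exact Phase.add_mem_cl _ h hx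

theorem sem_mul {X Y : Set (Space Q)} {A C : Formula}
    (hA : Phase.sem (pole M) (valuation ν) A = Phase.cl (pole M) X)
    (hC : Phase.sem (pole M) (valuation ν) C = Phase.cl (pole M) Y) :
    Phase.sem (pole M) (valuation ν) (.mul A C) = Phase.cl (pole M) (X + Y) := by
  rw [Phase.sem, hA, hC, Phase.cl_cl_add_cl]

theorem sem_or {X Y : Set (Space Q)} {A C : Formula}
    (hA : Phase.sem (pole M) (valuation ν) A = Phase.cl (pole M) X)
    (hC : Phase.sem (pole M) (valuation ν) C = Phase.cl (pole M) Y) :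
    Phase.sem (pole M) (valuation ν) (.or A C) = Phase.cl (pole M) (X ∪ Y) := by
  rw [Phase.sem, hA, hC, Phase.cl_cl_union_cl]

theorem natCast_mul_single_one (n : ℕ) (r : Register) :
    (n : Register → ℕ) * Pi.single r 1 = Pi.single r n := by
  ext r'
  by_cases h : r' = r
  · subst h
    simp
  · simp [h]

theorem single_add_eq_update (v : Register → ℕ) (r : Register) :
    Pi.single r 1 + v = Function.update v r (v r + 1) := by
  ext r'
  by_cases h : r' = r
  · subst h
    simp [add_comm]
  · simp [h]

theorem update_single_add_sub (v : Register → ℕ) (r : Register) :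
    Function.update (Pi.single r 1 + v) r ((Pi.single r 1 + v : Register → ℕ) r - 1) = v := by
  ext r'
  by_cases h : r' = r
  · subst h
    simp
  · simp [h]

theorem sem_star_counter (hν : Function.Injective ν) (r : Register) :
    Phase.sem (pole M) (valuation ν) (.star (counterVar ν r)) =
      Phase.cl (pole M) (Set.range fun n : ℕ => (0, 0, Pi.single r n, 0)) := by
  rw [Phase.sem, counterVar, sem_symb hν, Phase.cl_iUnion_nsmul_cl]
  congr 1
  ext m
  simp [symbElem, natCast_mul_single_one, eq_comm]

theorem sem_bigOr_stateVar (hν : Function.Injective ν) (l : List Q) :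
    Phase.sem (pole M) (valuation ν) (bigOr (l.map (stateVar ν))) =
      Phase.cl (pole M) {m | ∃ q ∈ l, m = symbElem (.state q)} := by
  match l with
  | [] => simp [bigOr, Phase.sem]
  | [q] =>
    rw [List.map_singleton, bigOr, stateVar, sem_symb hν]
    simp
  | q :: q' :: l =>
    have ih := sem_bigOr_stateVar hν (q' :: l)
    rw [List.map_cons] at ih
    rw [List.map_cons, List.map_cons, bigOr, stateVar,
      sem_or (sem_symb hν _) ih]
    congr 1
    ext m
    simp

theorem sem_formulaD_subset (hν : Function.Injective ν) :
    Phase.sem (pole M) (valuation ν) (formulaD ν M) ⊆ pole M := by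
  have hs := sem_star_counter (M := M) hν
  have hz (r : Register) : Phase.sem (pole M) (valuation ν) (zVar ν r) = _ := sem_symb hν _
  rw [formulaD, sem_or (sem_mul (hs _) (sem_mul (hs _) (sem_mul (hs _) (sem_bigOr_stateVar hν _))))
    (sem_or (sem_mul (hs _) (sem_mul (hs _) (hz _)))
      (sem_or (sem_mul (hs _) (sem_mul (hs _) (hz _))) (sem_mul (hs _) (sem_mul (hs _) (hz _)))))]
  refine (Phase.cl_mono _ ?_).trans (Phase.cl_pole _)
  rintro m (h | h | h | h)
  · obtain ⟨_, ⟨i, rfl⟩, _, ⟨_, ⟨j, rfl⟩, _, ⟨_, ⟨k, rfl⟩, _, ⟨q, -, rfl⟩, rfl⟩, rfl⟩, rfl⟩ := h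
    -- The generators of `D` contain no copy of `E`, so only a computation of zero steps is
    -- required.
    exact Or.inl ⟨q, by simp [symbElem], by simp [symbElem], trivial⟩
  all_goals
    obtain ⟨_, ⟨i, rfl⟩, _, ⟨_, ⟨j, rfl⟩, _, rfl, rfl⟩, rfl⟩ := h
    exact Or.inr ⟨by simp [symbElem], _, by simp [symbElem]; rfl, by simp [symbElem]⟩

/-- The zero-test part of the pole does not restrict the number of copies of `E`, so an extra copy
does no harm next to `z_r`. -/
theorem sem_dummy (hν : Function.Injective ν) (r : Register) :
    (1, 0) ∈ Phase.sem (pole M) (valuation ν) (dummy ν r) := by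
  refine sem_imp (sem_symb hν _) (sem_symb hν _) ?_
  rintro _ rfl y hy
  have := hy _ rfl
  obtain ⟨n, s, v, z⟩ := y
  simp only [symbElem, pole, Set.mem_ofPred_eq, Prod.mk_add_mk] at this ⊢
  simp at this ⊢
  exact this

theorem sem_instrFormula (hν : Function.Injective ν) {I : Instruction Q}
    (hI : I ∈ M.instructions) :
    (1, 0) ∈ Phase.sem (pole M) (valuation ν) (instrFormula ν I) := by
  cases I with
  | inc p r q =>
    refine sem_imp (sem_symb hν _) (sem_mul (sem_symb hν _) (sem_symb hν _)) ?_
    rintro _ rfl ⟨n, s, v, z⟩ hy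
    have := hy _ ⟨_, rfl, _, rfl, rfl⟩
    simp [symbElem, pole] at this ⊢
    obtain ⟨q', hs, rfl, hr⟩ := this
    -- The pole admits a single state, here the target state, so the context contributes none.
    obtain ⟨rfl, rfl⟩ : q' = q ∧ s = 0 := (Multiset.singleton_eq_cons_iff _).1 (by simpa using hs.symm)
    refine ⟨p, rfl, rfl, ?_⟩
    rw [add_comm 1 n]
    rw [single_add_eq_update] at hr
    exact ⟨_, .inc v hI, hr⟩
  | jzdec p r q₀ q₁ =>
    refine ⟨sem_imp (sem_mul (sem_symb hν _) (sem_symb hν _)) (sem_symb hν _) ?_,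
      sem_imp (sem_symb hν _) (sem_or (sem_symb hν _) (sem_symb hν _)) ?_⟩
    · rintro _ ⟨_, rfl, _, rfl, rfl⟩ ⟨n, s, v, z⟩ hy
      have := hy _ rfl
      simp [symbElem, pole] at this ⊢
      obtain ⟨q', hs, rfl, hr⟩ := this
      obtain ⟨rfl, rfl⟩ : q' = q₁ ∧ s = 0 := (Multiset.singleton_eq_cons_iff _).1 (by simpa using hs.symm)
      refine ⟨p, rfl, rfl, ?_⟩
      rw [add_comm 1 n]
      refine ⟨_, .dec _ hI (by simp), ?_⟩
      rwa [update_single_add_sub]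
    · rintro _ rfl ⟨n, s, v, z⟩ hy
      -- The context must pass with both disjuncts: `q₀` supplies the run of `n` steps, and `z_r`
      -- certifies that the register is zero.
      have h₁ := hy _ (Or.inl rfl)
      have h₂ := hy _ (Or.inr rfl)
      simp [symbElem, pole] at h₁ h₂ ⊢
      obtain ⟨q', hs, rfl, hr⟩ := h₁
      obtain ⟨rfl, rfl⟩ : q' = q₀ ∧ s = 0 := (Multiset.singleton_eq_cons_iff _).1 (by simpa using hs.symm)
      obtain ⟨-, r', hr', hv⟩ := h₂
      obtain rfl : r = r' := by simpa using hr'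
      refine ⟨p, rfl, rfl, ?_⟩
      rw [add_comm 1 n]
      exact ⟨_, .jz _ hI hv, hr⟩

theorem sem_bigAnd {X : Space Q} {A : Formula} {l : List Formula}
    (h : ∀ C ∈ A :: l, X ∈ Phase.sem (pole M) (valuation ν) C) :
    X ∈ Phase.sem (pole M) (valuation ν) (bigAnd A l) := by
  induction l generalizing A with
  | nil => exact h A (by simp)
  | cons C l ih => exact ⟨h A (by simp), ih fun C' hC => h C' (List.mem_cons_of_mem _ hC)⟩

theorem sem_formulaE (hν : Function.Injective ν) :
    (1, 0) ∈ Phase.sem (pole M) (valuation ν) (formulaE ν M) := by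
  refine sem_bigAnd fun C hC => ?_
  simp only [List.mem_cons, List.mem_map] at hC
  obtain rfl | rfl | rfl | ⟨I, hI, rfl⟩ := hC
  · exact sem_dummy hν _
  · exact sem_dummy hν _
  · exact sem_dummy hν _
  · exact sem_instrFormula hν hI

theorem runsForever_of_derivable (hν : Function.Injective ν) {x : ℕ}
    (h : Derivable ({Formula.star (formulaE ν M)} + {stateVar ν M.start} +
      Multiset.replicate x (counterVar ν .a)) (formulaD ν M)) : M.RunsForever x := by
  rw [Machine.runsForever_iff]
  intro n
  have h := Phase.sound (pole M) (valuation ν) h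
  rw [Phase.ctx_add, Phase.ctx_add, Phase.ctx_singleton, Phase.ctx_singleton,
    Phase.ctx_replicate] at h
  have h₁ : n • ((1, 0) : Space Q) ∈
      -- The `n`-fold sum of `(1, 0)` belongs to `E*` for each `n`, so membership of the whole
      -- antecedent in the pole demands a run of `n` steps.
      Phase.sem (pole M) (valuation ν) (.star (formulaE ν M)) :=
    Phase.subset_cl _ _ (Set.mem_iUnion.2 ⟨n, Set.nsmul_mem_nsmul (sem_formulaE hν)⟩)
  have h₂ (s : Symb Q) : symbElem s ∈ Phase.sem (pole M) (valuation ν) (.var (ν s)) := by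
    rw [sem_symb hν]
    exact Phase.subset_cl _ _ rfl
  have := sem_formulaD_subset hν (h ⟨_, ⟨_, h₁, _, h₂ _, rfl⟩, _,
    Set.nsmul_mem_nsmul (h₂ (.counter .a)), rfl⟩)
  have hv : (M.init x).val = Pi.single .a x := by
    ext r
    simp [Machine.init, Pi.single_apply]
  have hx : M.Runs n ⟨M.start, Pi.single .a x⟩ := by
    simpa [pole, symbElem, natCast_mul_single_one] using this
  rwa [← hv] at hx

end Model

/-! ### From computations to derivations -/

section Derivations

theorem Derivable.star_replicate (A : Formula) (n : ℕ) :
    Derivable (Multiset.replicate n A) (.star A) := by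
  have := Derivable.starR (A := A) n (fun _ => {A}) fun _ => .id A
  simpa [Multiset.nsmul_singleton] using this

theorem Derivable.bigAndL {Γ : Multiset Formula} {A B C : Formula} {l : List Formula}
    (hB : B ∈ A :: l) (h : Derivable (Γ + {B}) C) : Derivable (Γ + {bigAnd A l}) C := by
  induction l generalizing A with
  | nil =>
    rw [List.mem_singleton] at hB
    exact hB ▸ h
  | cons D l ih =>
    rcases List.mem_cons.1 hB with rfl | hB
    · exact .andL₁ h
    · exact .andL₂ (ih hB)

theorem Derivable.bigOrR {Γ : Multiset Formula} {A : Formula} {l : List Formula}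
    (hA : A ∈ l) (h : Derivable Γ A) : Derivable Γ (bigOr l) := by
  match l with
  | [B] =>
    rw [List.mem_singleton] at hA
    exact hA ▸ h
  | B :: D :: l =>
    rcases List.mem_cons.1 hA with rfl | hA
    · exact .orR₁ h
    · exact .orR₂ (bigOrR hA h)

variable (ν : Symb Q → ℕ)

/-- The counters of a configuration as a multiset of variables. -/
def counters (v : Register → ℕ) : Multiset Formula :=
  Multiset.replicate (v .a) (counterVar ν .a) + Multiset.replicate (v .b) (counterVar ν .b) +
    Multiset.replicate (v .c) (counterVar ν .c)

theorem counters_inc (v : Register → ℕ) (r : Register) :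
    counters ν (Function.update v r (v r + 1)) = counters ν v + {counterVar ν r} := by
  cases r <;> simp [counters, Multiset.replicate_succ, ← Multiset.singleton_add] <;> abel

theorem counters_dec (v : Register → ℕ) (r : Register) (h : v r ≠ 0) :
    counters ν (Function.update v r (v r - 1)) + {counterVar ν r} = counters ν v := by
  rw [← counters_inc]
  congr 1
  ext r'
  by_cases hr : r' = r
  · subst hr
    simp
    omega
  · simp [hr]

theorem derivable_state (v : Register → ℕ) (q : Q) :
    Derivable (counters ν v + {stateVar ν q}) (formulaD ν M) := by
  have hs (r : Register) := Derivable.star_replicate (counterVar ν r) (v r)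
  have := (hs .a).mulR ((hs .b).mulR ((hs .c).mulR
    (Derivable.bigOrR (List.mem_map_of_mem (M.mem_states q)) (.id (stateVar ν q)))))
  refine .orR₁ ?_
  simpa only [counters, add_assoc] using this

theorem derivable_ztest (v : Register → ℕ) (r : Register) (h : v r = 0) :
    Derivable (counters ν v + {zVar ν r}) (formulaD ν M) := by
  have hs (r : Register) := Derivable.star_replicate (counterVar ν r) (v r)
  have hz := Derivable.id (zVar ν r)
  cases r
  · refine .orR₂ (.orR₁ ?_)
    simpa [counters, h, add_assoc] using (hs .b).mulR ((hs .c).mulR hz)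
  · refine .orR₂ (.orR₂ (.orR₁ ?_))
    simpa [counters, h, add_assoc] using (hs .a).mulR ((hs .c).mulR hz)
  · refine .orR₂ (.orR₂ (.orR₂ ?_))
    simpa [counters, h, add_assoc] using (hs .a).mulR ((hs .b).mulR hz)

theorem derivable_replicate_ztest (n : ℕ) (v : Register → ℕ) (r : Register) (h : v r = 0) :
    Derivable (Multiset.replicate n (formulaE ν M) + counters ν v + {zVar ν r})
      (formulaD ν M) := by
  induction n with
  | zero => simpa using derivable_ztest ν v r h
  | succ n ih =>
    have hm : dummy ν r ∈ dummy ν .a :: dummy ν .b :: dummy ν .c ::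
        M.instructions.map (instrFormula ν) := by cases r <;> simp
    -- One copy of `E` is consumed as `N_r`, which takes `z_r` and gives it back.
    have := Derivable.bigAndL hm (.impL (.id _) ih)
    rw [Multiset.replicate_succ, ← Multiset.singleton_add]
    convert this using 1
    rw [formulaE]
    abel

theorem derivable_of_runs (n : ℕ) (q : Q) (v : Register → ℕ) (h : M.Runs n ⟨q, v⟩) :
    Derivable (Multiset.replicate n (formulaE ν M) + counters ν v + {stateVar ν q})
      (formulaD ν M) := by
  induction n generalizing q v with
  | zero => simpa using derivable_state ν v q
  | succ n ih =>
    obtain ⟨⟨q', v'⟩, hs, hr⟩ := h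
    have ih := ih q' v' hr
    have hm {I : Instruction Q} (hI : I ∈ M.instructions) : instrFormula ν I ∈
        dummy ν .a :: dummy ν .b :: dummy ν .c :: M.instructions.map (instrFormula ν) := by
      simp only [List.mem_cons, List.mem_map]
      exact .inr (.inr (.inr ⟨I, hI, rfl⟩))
    rw [Multiset.replicate_succ, ← Multiset.singleton_add]
    cases hs with
    | @inc _ _ r _ hI =>
      rw [counters_inc] at ih
      have := Derivable.bigAndL (hm hI) (Γ := Multiset.replicate n (formulaE ν M) + counters ν v +
        {stateVar ν q}) (.impL (.id _) (.mulL (by convert ih using 1; abel)))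
      convert this using 1
      rw [formulaE]
      abel
    | @jz _ _ q₁ r _ hI hv =>
      -- The `q₀` branch follows the computation; the `z_r` branch closes because the register is
      -- zero.
      have := Derivable.bigAndL (hm hI) (.andL₂ (.impL (.id _)
        (.orL ih (derivable_replicate_ztest ν n v r hv))))
      convert this using 1
      rw [formulaE]
      abel
    | @dec _ q₀ _ r _ hI hv =>
      have := Derivable.bigAndL (hm hI) (.andL₁ (.impL
        (.mulR (.id (stateVar ν q)) (.id (counterVar ν r))) ih))
      convert this using 1
      rw [formulaE, ← counters_dec ν v r hv]
      abel

theorem derivable_of_runsForever {x : ℕ} (h : M.RunsForever x) :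
    Derivable ({Formula.star (formulaE ν M)} + {stateVar ν M.start} +
      Multiset.replicate x (counterVar ν .a)) (formulaD ν M) := by
  rw [Machine.runsForever_iff] at h
  have := Derivable.starL fun n => by
    have := derivable_of_runs ν n _ _ (h n)
    rwa [add_assoc, add_comm] at this
  convert this using 1
  simp only [counters, reduceIte, reduceCtorEq, Multiset.replicate_zero, add_zero]
  abel

end Derivations

theorem runsForever_iff_derivable {ν : Symb Q → ℕ} (hν : Function.Injective ν) (x : ℕ) :
    M.RunsForever x ↔ Derivable ({Formula.star (formulaE ν M)} + {stateVar ν M.start} +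
      Multiset.replicate x (counterVar ν .a)) (formulaD ν M) :=
  ⟨derivable_of_runsForever ν, runsForever_of_derivable hν⟩

end CommACT

namespace CommACT

open Turing StateTransition

/-! ### Counter machines given by a function -/

/-- By determinism an infinite sequence passes through every reachable point, so none is terminal.
Conversely, if `eval` diverges, every reachable point has a successor, again reachable. -/
theorem exists_seq_iff_not_eval_dom {σ : Type*} (f : σ → Option σ) (a : σ) :
    (∃ c : ℕ → σ, c 0 = a ∧ ∀ n, c (n + 1) ∈ f (c n)) ↔ ¬ (eval f a).Dom := by
  constructor
  · rintro ⟨c, rfl, hc⟩ hd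
    obtain ⟨hr, hn⟩ := mem_eval.1 (Part.get_mem hd)
    have key : ∀ b, Reaches f (c 0) b → ∃ n, b = c n := by
      intro b hb
      induction hb with
      | refl => exact ⟨0, rfl⟩
      | tail _ h ih =>
        obtain ⟨n, rfl⟩ := ih
        exact ⟨n + 1, Option.mem_unique h (hc n)⟩
    obtain ⟨n, h⟩ := key _ hr
    have := hc n
    rw [← h, hn] at this
    cases this
  · intro hd
    have next (b : {b // Reaches f a b}) : ∃ b' : {b // Reaches f a b}, b'.1 ∈ f b.1 := by
      obtain ⟨b, hb⟩ := b
      cases h : f b with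
      | none => exact absurd (Part.dom_iff_mem.2 ⟨b, mem_eval.2 ⟨hb, h⟩⟩) hd
      | some b' => exact ⟨⟨b', hb.tail h⟩, rfl⟩
    choose g hg using next
    refine ⟨fun n => (g^[n] ⟨a, .refl⟩).1, rfl, fun n => ?_⟩
    simp only [Function.iterate_succ_apply']
    exact hg _

/-- The effect of an instruction on the registers. -/
def Instruction.exec {Q : Type*} (v : Register → ℕ) : Instruction Q → Config Q
  | .inc _ r q => ⟨q, Function.update v r (v r + 1)⟩
  | .jzdec _ r q₀ q₁ =>
    if v r = 0 then ⟨q₀, v⟩ else ⟨q₁, Function.update v r (v r - 1)⟩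

/-- The step function of a counter machine given by a partial function from states to
instructions. -/
def stepFun {Q : Type*} (op : Q → Option (Instruction Q)) (c : Config Q) : Option (Config Q) :=
  (op c.state).map (Instruction.exec c.val)

/-- The counter machine given by a partial function from states to instructions. -/
noncomputable def Machine.ofFun {Q : Type*} [Fintype Q] (op : Q → Option (Instruction Q))
    (hop : ∀ p, ∀ I ∈ op p, I.source = p) (start final : Q)
    (hfinal : ∀ q, q = final ↔ op q = none) : Machine Q where
  states := Finset.univ.toList
  mem_states q := by simp
  instructions := Finset.univ.toList.filterMap op
  start := start
  final := final
  deterministic I hI J hJ h := by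
    simp only [List.mem_filterMap, Finset.mem_toList, Finset.mem_univ, true_and] at hI hJ
    obtain ⟨p, hp⟩ := hI
    obtain ⟨p', hp'⟩ := hJ
    rw [hop p I hp, hop p' J hp'] at h
    subst h
    exact Option.mem_unique hp hp'
  eq_final_iff q := by
    rw [hfinal, Option.eq_none_iff_forall_not_mem]
    simp only [List.mem_filterMap, Finset.mem_toList, Finset.mem_univ, true_and]
    refine ⟨fun h I ⟨p, hp⟩ hs => h I ?_, fun h I hI => h I ⟨q, hI⟩ (hop q I hI)⟩
    rw [hop p I hp] at hs
    exact hs ▸ hp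

theorem Machine.ofFun_step_iff {Q : Type*} [Fintype Q] {op : Q → Option (Instruction Q)}
    {hop : ∀ p, ∀ I ∈ op p, I.source = p} {start final : Q}
    {hfinal : ∀ q, q = final ↔ op q = none} {c c' : Config Q} :
    (Machine.ofFun op hop start final hfinal).Step c c' ↔ c' ∈ stepFun op c := by
  have hmem (I : Instruction Q) :
      I ∈ (Machine.ofFun op hop start final hfinal).instructions ↔ I ∈ op I.source := by
    simp only [Machine.ofFun, List.mem_filterMap, Finset.mem_toList, Finset.mem_univ, true_and]
    refine ⟨fun ⟨p, hp⟩ => ?_, fun h => ⟨_, h⟩⟩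
    rw [hop p I hp]
    exact hp
  constructor
  · intro h
    cases h with
    | inc v h => exact Option.mem_map.2 ⟨_, (hmem _).1 h, rfl⟩
    | jz v h hv => exact Option.mem_map.2 ⟨_, (hmem _).1 h, if_pos hv⟩
    | dec v h hv => exact Option.mem_map.2 ⟨_, (hmem _).1 h, if_neg hv⟩
  · intro h
    obtain ⟨I, hI, rfl⟩ := Option.mem_map.1 h
    obtain ⟨p, v⟩ := c
    obtain rfl : I.source = p := hop _ _ hI
    cases I with
    | inc p r q => exact .inc v ((hmem _).2 hI)
    | jzdec p r q₀ q₁ =>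
      simp only [Instruction.exec]
      split_ifs with hv
      · exact .jz v ((hmem _).2 hI) hv
      · exact .dec v ((hmem _).2 hI) hv

theorem Machine.ofFun_runsForever_iff {Q : Type*} [Fintype Q] {op : Q → Option (Instruction Q)}
    {hop : ∀ p, ∀ I ∈ op p, I.source = p} {start final : Q}
    {hfinal : ∀ q, q = final ↔ op q = none} {x : ℕ} :
    (Machine.ofFun op hop start final hfinal).RunsForever x ↔
      ¬ (eval (stepFun op) ⟨start, fun r => if r = Register.a then x else 0⟩).Dom := by
  rw [← exists_seq_iff_not_eval_dom]
  simp only [Machine.RunsForever, Machine.ofFun_step_iff]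
  rfl

/-! ### Simulation of Turing machines -/

namespace TMSim

instance : Fintype Dir where
  elems := {.left, .right}
  complete d := by cases d <;> decide

/-- States of the counter machine that simulates a Turing machine with states `Λ` and alphabet `Γ`
of size `k + 1`: the left and the right part of the tape are numbers in base `k + 1`, the symbol
under the head is part of the state, and a move in direction `d` multiplies one of the numbers by
`k + 1`, adds the code of a symbol, and divides the other number by `k + 1`. -/
inductive State (Λ Γ : Type) (k : ℕ) : Type
  | halt
  | main (q : Λ) (s : Γ)
  | mul (d : Dir) (q : Λ) (s : Γ)
  | mulInc (d : Dir) (q : Λ) (s : Γ) (j : Fin (k + 1))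
  | back (d : Dir) (q : Λ) (s : Γ)
  | backInc (d : Dir) (q : Λ) (s : Γ)
  | add (d : Dir) (q : Λ) (j : Fin (k + 1))
  | div (d : Dir) (q : Λ) (j : Fin (k + 1))
  | divInc (d : Dir) (q : Λ)
  | restore (d : Dir) (q : Λ) (j : Fin (k + 1))
  | restoreInc (d : Dir) (q : Λ) (j : Fin (k + 1))
  deriving Fintype

/-- The register for the part of the tape that grows in a move. -/
def push : Dir → Register
  | .left => .a
  | .right => .b

/-- The register for the part of the tape that shrinks in a move. -/
def pop : Dir → Register
  | .left => .b
  | .right => .a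

/-- The register values with given values of the registers `push d`, `pop d`, `c`. -/
def vals (d : Dir) (p o z : ℕ) : Register → ℕ
  | .a => match d with
    | .left => p
    | .right => o
  | .b => match d with
    | .left => o
    | .right => p
  | .c => z

section vals

variable (d : Dir) (p o z n : ℕ)

@[simp] theorem vals_push : vals d p o z (push d) = p := by cases d <;> rfl

@[simp] theorem vals_pop : vals d p o z (pop d) = o := by cases d <;> rfl

@[simp] theorem vals_c : vals d p o z .c = z := by cases d <;> rfl

@[simp] theorem update_push : Function.update (vals d p o z) (push d) n = vals d n o z := by
  ext r; cases d <;> cases r <;> simp [vals, push]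

@[simp] theorem update_pop : Function.update (vals d p o z) (pop d) n = vals d p n z := by
  ext r; cases d <;> cases r <;> simp [vals, pop]

@[simp] theorem update_c : Function.update (vals d p o z) .c n = vals d p o n := by
  ext r; cases d <;> cases r <;> simp [vals]

end vals

variable {Λ Γ : Type} {k : ℕ} [Inhabited Λ] (M : TM0.Machine Γ Λ)
  (e : Γ ≃ Fin (k + 1))

/-- The state of the counter machine between two steps of the Turing machine. -/
def mainState (q : Λ) (s : Γ) : State Λ Γ k :=
  match M q s with
  | none => .halt
  | some _ => .main q s

open State in
/-- The instructions of the simulating machine. -/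
def op : State Λ Γ k → Option (Instruction (State Λ Γ k))
  | halt => none
  | main q s => match M q s with
    | none => some (.jzdec (main q s) .c halt halt)
    | some (q', .move d) => some (.jzdec (main q s) .c (mul d q' s) halt)
    | some (q', .write s') => some (.jzdec (main q s) .c (mainState M q' s') halt)
  | mul d q s => some (.jzdec (mul d q s) (push d) (back d q s) (mulInc d q s (Fin.last k)))
  | mulInc d q s j => some (.inc (mulInc d q s j) .c
      (if j = 0 then mul d q s else mulInc d q s (j - 1)))
  | back d q s => some (.jzdec (back d q s) .c (add d q (e s)) (backInc d q s))
  | backInc d q s => some (.inc (backInc d q s) (push d) (back d q s))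
  | add d q j =>
    if j = 0 then some (.jzdec (add d q j) .c (div d q 0) halt)
    else some (.inc (add d q j) (push d) (add d q (j - 1)))
  | div d q j => some (.jzdec (div d q j) (pop d) (restore d q j)
      (if j = Fin.last k then divInc d q else div d q (j + 1)))
  | divInc d q => some (.inc (divInc d q) .c (div d q 0))
  | restore d q j =>
    some (.jzdec (restore d q j) .c (mainState M q (e.symm j)) (restoreInc d q j))
  | restoreInc d q j => some (.inc (restoreInc d q j) (pop d) (restore d q j))

theorem op_source (p : State Λ Γ k) : ∀ I ∈ op M e p, I.source = p := by
  intro I hI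
  cases p <;> simp only [op] at hI <;> first | (split at hI) | skip
  all_goals first | cases hI
  all_goals rfl

/-- Every state but the final one needs an instruction, so `op` also gives one to the states `main q
s` at which the Turing machine stops; `mainState` replaces these by `halt`. -/
theorem eq_halt_iff (p : State Λ Γ k) : p = .halt ↔ op M e p = none := by
  cases p <;> simp only [op, reduceCtorEq] <;> split <;> simp

theorem step_reaches {σ : Type*} {f : σ → Option σ} {a b c : σ} (h : f a = some b)
    (h' : Reaches f b c) : Reaches f a c := h'.head h

/-! ### Arithmetic subroutines: multiplication and division by the alphabet size. -/

variable (d : Dir) (q : Λ) (s : Γ)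

/-- Register `c` is incremented once for each index from `j` down to `0` inclusive, whence `j + 1`;
entering at `Fin.last k` adds the base `k + 1`. -/
theorem reaches_mulInc (j : Fin (k + 1)) (p o z : ℕ) :
    Reaches (stepFun (op M e)) ⟨.mulInc d q s j, vals d p o z⟩
      ⟨.mul d q s, vals d p o (z + j + 1)⟩ := by
  generalize hn : j.val = n
  induction n generalizing j z with
  | zero =>
    obtain rfl : j = 0 := Fin.ext hn
    exact step_reaches (by simp [stepFun, op, Instruction.exec]) .refl
  | succ n ih =>
    have hj : j ≠ 0 := by rintro rfl; simp at hn
    refine step_reaches (by simp [stepFun, op, Instruction.exec, hj]; rfl) ?_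
    convert ih (j - 1) (z + 1) (by rw [Fin.coe_sub_one, if_neg hj]; omega) using 3
    omega

theorem reaches_mul (p o z : ℕ) :
    Reaches (stepFun (op M e)) ⟨.mul d q s, vals d p o z⟩
      ⟨.back d q s, vals d 0 o (z + (k + 1) * p)⟩ := by
  induction p generalizing z with
  | zero => exact step_reaches (by simp [stepFun, op, Instruction.exec]) .refl
  | succ p ih =>
    refine step_reaches (by simp [stepFun, op, Instruction.exec]; rfl) ?_
    have : Reaches (stepFun (op M e)) _ _ :=
      (reaches_mulInc M e d q s (Fin.last k) p o z).trans (ih _)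
    rw [Fin.val_last] at this
    convert this using 3
    ring

theorem reaches_back (p o z : ℕ) :
    Reaches (stepFun (op M e)) ⟨.back d q s, vals d p o z⟩
      ⟨.add d q (e s), vals d (p + z) o 0⟩ := by
  induction z generalizing p with
  | zero => exact step_reaches (by simp [stepFun, op, Instruction.exec]) .refl
  | succ z ih =>
    refine step_reaches (by simp [stepFun, op, Instruction.exec]; rfl) ?_
    refine step_reaches (by simp [stepFun, op, Instruction.exec]; rfl) ?_
    convert ih (p + 1) using 3
    omega

theorem reaches_add (j : Fin (k + 1)) (p o : ℕ) :
    Reaches (stepFun (op M e)) ⟨.add d q j, vals d p o 0⟩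
      ⟨.div d q 0, vals d (p + j) o 0⟩ := by
  generalize hn : j.val = n
  induction n generalizing j p with
  | zero =>
    obtain rfl : j = 0 := Fin.ext hn
    exact step_reaches (by simp [stepFun, op, Instruction.exec]) .refl
  | succ n ih =>
    have hj : j ≠ 0 := by rintro rfl; simp at hn
    refine step_reaches (by simp [stepFun, op, Instruction.exec, hj]; rfl) ?_
    convert ih (j - 1) (p + 1) (by rw [Fin.coe_sub_one, if_neg hj]; omega) using 3
    omega

/-- The index in the state counts decrements modulo `k + 1` and each wrap-around increments `c`.
When the register is empty, `c` has received the quotient and the index is the remainder. -/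
theorem reaches_div (j : Fin (k + 1)) (p o z : ℕ) :
    Reaches (stepFun (op M e)) ⟨.div d q j, vals d p o z⟩
      ⟨.restore d q (Fin.ofNat (k + 1) (o + j)), vals d p 0 (z + (o + j) / (k + 1))⟩ := by
  induction o generalizing j z with
  | zero =>
    refine step_reaches (by simp [stepFun, op, Instruction.exec]; rfl) ?_
    simp [Nat.div_eq_of_lt j.isLt]
    exact .refl
  | succ o ih =>
    by_cases hj : j = Fin.last k
    · refine step_reaches (by simp [stepFun, op, Instruction.exec, hj]; rfl) ?_
      refine step_reaches (by simp [stepFun, op, Instruction.exec]; rfl) ?_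
      have ho : o + 1 + j.val = o + (k + 1) := by rw [hj, Fin.val_last]; ring
      convert ih 0 (z + 1) using 3
      · rw [ho]; ext; simp
      · rw [ho]; simp; ring
    · refine step_reaches (by simp [stepFun, op, Instruction.exec, hj]; rfl) ?_
      have ho : o + 1 + j.val = o + (j + 1).val := by rw [Fin.val_add_one, if_neg hj]; ring
      rw [ho]
      exact ih _ _

theorem reaches_restore (j : Fin (k + 1)) (p o z : ℕ) :
    Reaches (stepFun (op M e)) ⟨.restore d q j, vals d p o z⟩
      ⟨mainState M q (e.symm j), vals d p (o + z) 0⟩ := by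
  induction z generalizing o with
  | zero => exact step_reaches (by simp [stepFun, op, Instruction.exec]) .refl
  | succ z ih =>
    refine step_reaches (by simp [stepFun, op, Instruction.exec]; rfl) ?_
    refine step_reaches (by simp [stepFun, op, Instruction.exec]; rfl) ?_
    convert ih (o + 1) using 3
    omega

/-- The old symbol becomes the lowest digit of the growing half, and the lowest digit of the
shrinking half becomes the scanned symbol. -/
theorem reaches_move (p o : ℕ) :
    Reaches (stepFun (op M e)) ⟨.mul d q s, vals d p o 0⟩
      ⟨mainState M q (e.symm (Fin.ofNat (k + 1) o)),
        vals d ((k + 1) * p + e s) (o / (k + 1)) 0⟩ := by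
  have := (((reaches_mul M e d q s p o 0).trans (reaches_back M e d q s _ _ _)).trans
    (reaches_add M e d q _ _ _)).trans (reaches_div M e d q _ _ _ _)
  simpa [Reaches] using this.trans (reaches_restore M e d q _ _ _ _)

variable [Inhabited Γ]

/-- A number is the code of one side of the tape. -/
def Codes (n : ℕ) (l : ListBlank Γ) : Prop :=
  ∀ i, l.nth i = e.symm (Fin.ofNat (k + 1) (n / (k + 1) ^ i))

variable {e}

theorem Codes.cons {n : ℕ} {l : ListBlank Γ} (h : Codes e n l) :
    Codes e ((k + 1) * n + e s) (l.cons s) := by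
  intro i
  cases i with
  | zero =>
    rw [ListBlank.nth_zero, ListBlank.head_cons, Equiv.eq_symm_apply]
    ext
    simp [Nat.mod_eq_of_lt (e s).isLt]
  | succ i =>
    rw [ListBlank.nth_succ, ListBlank.tail_cons, h, pow_succ', ← Nat.div_div_eq_div_mul]
    congr 3
    rw [Nat.mul_add_div (Nat.succ_pos k), Nat.div_eq_of_lt (e s).isLt, add_zero]

theorem Codes.tail {n : ℕ} {l : ListBlank Γ} (h : Codes e n l) :
    Codes e (n / (k + 1)) l.tail := by
  intro i
  rw [← ListBlank.nth_succ, h, pow_succ', Nat.div_div_eq_div_mul]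

theorem Codes.head {n : ℕ} {l : ListBlank Γ} (h : Codes e n l) :
    l.head = e.symm (Fin.ofNat (k + 1) n) := by
  rw [← ListBlank.nth_zero, h]
  simp

/-- With the blank as digit `0`, the leading zeros of a number are the blank remainder of the tape.
-/
theorem codes_zero (he : e.symm 0 = default) : Codes e 0 (ListBlank.mk []) := by
  intro i
  simp [he, ListBlank.nth_mk]

variable (e) in
/-- The code of a list of symbols. -/
def code (l : List Γ) : ℕ := l.foldr (fun s n => (k + 1) * n + e s) 0

theorem codes_code (he : e.symm 0 = default) (l : List Γ) :
    Codes e (code e l) (ListBlank.mk l) := by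
  induction l with
  | nil => exact codes_zero he
  | cons s l ih => exact ListBlank.cons_mk s l ▸ ih.cons s

variable (e) in
/-- The relation between the configurations of the Turing machine and of the counter machine. -/
def TrCfg (c : TM0.Cfg Γ Λ) (c' : Config (State Λ Γ k)) : Prop :=
  ∃ m n, c' = ⟨mainState M c.q c.Tape.head, vals .right m n 0⟩ ∧ Codes e m c.Tape.left ∧
    Codes e n c.Tape.right

theorem vals_left (p o z : ℕ) : vals .left p o z = vals .right o p z := by
  ext r; cases r <;> rfl

theorem respects : Respects (TM0.step M) (stepFun (op M e)) (TrCfg M e) := by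
  rintro ⟨q, s, L, R⟩ _ ⟨m, n, rfl, hm, hn⟩
  simp only at hm hn
  cases h : M q s with
  | none => simp [TM0.step, h, mainState, stepFun, op]
  | some a =>
    obtain ⟨q', d | s'⟩ := a
    · simp only [TM0.step, h, Option.map_some, mainState]
      cases d with
      | left =>
        refine ⟨_, ⟨_, _, rfl, hm.tail, hn.cons s⟩, ?_⟩
        refine .head' (by simp [stepFun, op, Instruction.exec, h]; rfl) ?_
        have := reaches_move M e .left q' s n m
        rw [vals_left, vals_left, ← hm.head] at this
        exact this
      | right =>
        refine ⟨_, ⟨_, _, rfl, hm.cons s, hn.tail⟩, ?_⟩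
        refine .head' (by simp [stepFun, op, Instruction.exec, h]; rfl) ?_
        have := reaches_move M e .right q' s m n
        rw [← hn.head] at this
        exact this
    · simp only [TM0.step, h, Option.map_some, mainState]
      refine ⟨_, ⟨m, n, rfl, hm, hn⟩, .single ?_⟩
      simp [stepFun, op, Instruction.exec, h, Tape.write]

/-- The counter machine that simulates a Turing machine. -/
noncomputable def machine [Fintype Λ] [Fintype Γ] (M : TM0.Machine Γ Λ) (e : Γ ≃ Fin (k + 1)) :
    Machine (State Λ Γ k) :=
  Machine.ofFun (op M e) (op_source M e) (.mul .right default default) .halt (eq_halt_iff M e)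

theorem machine_runsForever_iff [Fintype Λ] [Fintype Γ] (he : e.symm 0 = default) (l : List Γ) :
    (machine M e).RunsForever (code e l) ↔ ¬ (TM0.eval M l).Dom := by
  rw [machine, Machine.ofFun_runsForever_iff, not_iff_not]
  have hv : (fun r => if r = Register.a then code e l else 0) = vals .right 0 (code e l) 0 := by
    ext r; cases r <;> rfl
  have hc := codes_code he l
  have he' : (e default : Fin (k + 1)).val = 0 := by simp [← he]
  -- The whole input sits in register `a`, and the machine starts inside a right move off a blank
  -- cell: this loads the first symbol and leaves the left half `0`, the blank having digit `0`.
  rw [hv, reaches_eval (reaches_move M e .right default default 0 (code e l))]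
  refine tr_eval_dom (a₁ := TM0.init l) (respects M) ⟨(k + 1) * 0 + e default, _, ?_, ?_, hc.tail⟩
  · rw [← hc.head]
    rfl
  · rw [he']
    exact codes_zero he

end TMSim
end CommACT

namespace CommACT

open Turing

/-! ### Hardness -/

theorem exists_equiv_fin_symm_zero (Γ : Type*) [Fintype Γ] [Inhabited Γ] :
    ∃ (k : ℕ) (e : Γ ≃ Fin (k + 1)), e.symm 0 = default := by
  obtain ⟨k, hk⟩ := Nat.exists_eq_succ_of_ne_zero (Fintype.card_ne_zero (α := Γ))
  let e := Fintype.equivFinOfCardEq hk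
  exact ⟨k, e.trans (Equiv.swap (e default) 0), by simp⟩

/-- A Turing machine with a finite set of accessible states is simulated by a counter machine. -/
theorem exists_machine_of_supports {Λ Γ : Type} [Inhabited Λ] [Inhabited Γ] [Fintype Γ]
    {k : ℕ} {e : Γ ≃ Fin (k + 1)} (he : e.symm 0 = default)
    (M : TM0.Machine Γ Λ) {S : Finset Λ} (hS : TM0.Supports M (S : Set Λ)) :
    ∃ (Q : Type) (_ : Finite Q) (N : Machine Q),
      ∀ l, N.RunsForever (TMSim.code e l) ↔ ¬ (TM0.eval M l).Dom := by
  classical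
  let : Inhabited S := ⟨⟨default, hS.1⟩⟩
  -- States outside `S` go to an arbitrary value; only accessible states matter, and these lie in
  -- `S`.
  let g : PointedMap Λ S := ⟨fun q => if h : q ∈ S then ⟨q, h⟩ else default, by
    have : default ∈ S := hS.1
    simp [this]; rfl⟩
  let f : PointedMap Γ Γ := ⟨id, rfl⟩
  refine ⟨_, inferInstance, TMSim.machine (M.map f f g Subtype.val) e, fun l => ?_⟩
  rw [TMSim.machine_runsForever_iff _ he, not_iff_not]
  refine StateTransition.tr_eval_dom (TM0.Machine.map_respects M f f g Subtype.val hS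
    (fun _ => rfl) fun q hq => ?_) (a₁ := TM0.init l) ⟨hS.1, ?_⟩
  · have : q ∈ S := hq
    simp [g, this]
  · rw [TM0.map_init]
    congr
    exact List.map_id l

instance : Fintype PartrecToTM2.K' where
  elems := {.main, .rev, .aux, .stack}
  complete k := by cases k <;> decide

theorem exists_machine_of_code (c : ToPartrec.Code) {k : ℕ}
    {e : TM2to1.Γ' PartrecToTM2.K' (fun _ => PartrecToTM2.Γ') ≃ Fin (k + 1)}
    (he : e.symm 0 = default) :
    ∃ (Q : Type) (_ : Finite Q) (N : Machine Q), ∀ v : List ℕ,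
      N.RunsForever (TMSim.code e
        (TM2to1.trInit PartrecToTM2.K'.main (PartrecToTM2.trList v))) ↔ ¬ (c.eval v).Dom := by
  -- The default state is the start state, so `c` enters through this instance.
  let : Inhabited PartrecToTM2.Λ' :=
    ⟨PartrecToTM2.trNormal c PartrecToTM2.Cont'.halt⟩
  obtain ⟨Q, hQ, N, hN⟩ := exists_machine_of_supports he _ (TM1to0.tr_supports _
    (TM2to1.tr_supports _ (PartrecToTM2.tr_supports c PartrecToTM2.Cont'.halt)))
  refine ⟨Q, hQ, N, fun v => ?_⟩
  rw [hN, TM1to0.tr_eval, not_iff_not]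
  refine (TM2to1.tr_eval_dom PartrecToTM2.tr _ _).trans ?_
  have h := PartrecToTM2.tr_eval c v
  have hi : PartrecToTM2.init c v = TM2.init PartrecToTM2.K'.main (PartrecToTM2.trList v) := by
    rw [PartrecToTM2.init, TM2.init]
    congr
    ext k : 1
    cases k <;> rfl
  rw [hi] at h
  exact (congrArg Part.Dom h).to_iff

open Nat.Partrec' in
theorem exists_code_of_rePred {p : ℕ → Prop} (hp : REPred p) :
    ∃ c : ToPartrec.Code, ∀ n, (c.eval [n]).Dom ↔ p n := by
  have h : Partrec fun n => (Part.assert (p n) fun _ => Part.some ()).map fun _ => 0 :=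
    Partrec.map hp (Computable.const 0).to₂
  obtain ⟨c, hc⟩ := ToPartrec.Code.exists_code (part_iff₁.2 h)
  refine ⟨c, fun n => ?_⟩
  have := hc ⟨[n], rfl⟩
  rw [this]
  simp [Part.assert]
  rfl

/-! ### Primitive recursiveness of the input encoding. -/

theorem trNat_eq_map_bits (n : ℕ) : PartrecToTM2.trNat n =
    n.bits.map fun b => bif b then PartrecToTM2.Γ'.bit1 else PartrecToTM2.Γ'.bit0 := by
  have key (m : PosNum) : PartrecToTM2.trPosNum m =
      (m : ℕ).bits.map fun b => bif b then PartrecToTM2.Γ'.bit1 else PartrecToTM2.Γ'.bit0 := by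
    induction m with
    | one => simp [PartrecToTM2.trPosNum]
    | bit0 m ih =>
      rw [PosNum.cast_bit0, ← two_mul, Nat.bit0_bits _ (PosNum.cast_pos m).ne']
      simp [PartrecToTM2.trPosNum, ih]
    | bit1 m ih =>
      rw [PosNum.cast_bit1, ← two_mul, Nat.bit1_bits]
      simp [PartrecToTM2.trPosNum, ih]
  rw [PartrecToTM2.trNat]
  conv_rhs => rw [← Num.to_of_nat n]
  cases (n : Num) with
  | zero => simp [PartrecToTM2.trNum]
  | pos m => exact key m

theorem primrec_bits : Primrec Nat.bits := by
  -- Course-of-values recursion: `l` lists the values below `n`, so its length is `n`, and the bits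
  -- of `n` are its parity followed by entry `n.div2`.
  have hg : Primrec fun l : List (List Bool) => if l.length = 0 then some []
      else (l[l.length.div2]?).map (List.cons l.length.bodd) := by
    refine Primrec.ite (Primrec.eq.comp Primrec.list_length (Primrec.const 0))
      (Primrec.const _) (Primrec.option_map
        (Primrec.list_getElem?.comp Primrec.id (Primrec.nat_div2.comp Primrec.list_length))
        (Primrec.list_cons.comp (Primrec.nat_bodd.comp (Primrec.list_length.comp Primrec.fst))
          Primrec.snd).to₂)
  refine (Primrec.nat_strong_rec (fun (_ : Unit) n => Nat.bits n) (hg.comp Primrec.snd).to₂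
    fun _ n => ?_).comp (Primrec.const ()) Primrec.id
  simp only [List.length_map, List.length_range]
  split_ifs with h
  · simp [h]
  · have : n.div2 < n := by rw [Nat.div2_val]; omega
    rw [List.getElem?_map, List.getElem?_range this]
    simp
    have hb := Nat.bits_append_bit n.div2 n.bodd fun h0 => by
      by_contra hb
      have := Nat.bodd_add_div2 n
      simp_all
    rw [Nat.bit_bodd_div2] at hb
    exact hb.symm

theorem primrec_code_trInit {k : ℕ}
    (e : TM2to1.Γ' PartrecToTM2.K' (fun _ => PartrecToTM2.Γ') ≃ Fin (k + 1)) :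
    Primrec fun n : ℕ => TMSim.code e
      (TM2to1.trInit PartrecToTM2.K'.main (PartrecToTM2.trList [n])) := by
  let φ (a : PartrecToTM2.Γ') : TM2to1.Γ' PartrecToTM2.K' (fun _ => PartrecToTM2.Γ') :=
    (false, Function.update (fun _ => none) .main (some a))
  let W (b : Bool) : ℕ := e (φ (bif b then .bit1 else .bit0))
  -- The stack is written reversed, so the `cons` marker, flagged as stack bottom, is the lowest
  -- digit, and the right fold over the reversed bits is a left fold over the bits.
  have h (n : ℕ) : TMSim.code e
      (TM2to1.trInit PartrecToTM2.K'.main (PartrecToTM2.trList [n])) =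
      (k + 1) * (n.bits.foldl (fun m b => (k + 1) * m + W b) 0) + e (true, (φ .cons).2) := by
    rw [TM2to1.trInit, PartrecToTM2.trList, PartrecToTM2.trList, trNat_eq_map_bits,
      List.reverse_append]
    change (k + 1) * ((List.map _ n.bits).reverse.map φ).foldr
      (fun s m => (k + 1) * m + (e s : ℕ)) 0 + _ = _
    rw [List.foldr_map, List.foldr_reverse, List.foldl_map]
    rfl
  have hf : Primrec fun n : ℕ => n.bits.foldl (fun m b => (k + 1) * m + W b) 0 := by
    refine Primrec.list_foldl primrec_bits (Primrec.const 0) (Primrec.nat_add.comp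
      (Primrec.nat_mul.comp (Primrec.const _) (Primrec.fst.comp Primrec.snd))
      ((Primrec.dom_bool W).comp (Primrec.snd.comp Primrec.snd))).to₂
  exact (Primrec.nat_add.comp (Primrec.nat_mul.comp (Primrec.const (k + 1)) hf)
    (Primrec.const _)).of_eq fun n => (h n).symm

theorem primrec_replicate {α : Type*} [Primcodable α] (a : α) :
    Primrec fun n : ℕ => List.replicate n a :=
  (Primrec.list_map Primrec.list_range (Primrec.const a).to₂).of_eq fun n => by
    simp

theorem exists_injective_symb (Q : Type*) [Finite Q] :
    ∃ ν : Symb Q → ℕ, Function.Injective ν := by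
  let f : Symb Q → Q ⊕ Register ⊕ Register
    | .state q => .inl q
    | .counter r => .inr (.inl r)
    | .ztest r => .inr (.inr r)
  have hf : Function.Injective f := by
    rintro (_ | _ | _) (_ | _ | _) h <;> simp [f] at h <;> simp [h]
  let g : Register → ℕ
    | .a => 0
    | .b => 1
    | .c => 2
  have hg : Function.Injective g := by
    rintro (_ | _ | _) (_ | _ | _) h <;> simp [g] at h <;> rfl
  have := hg.countable
  have := hf.countable
  exact exists_injective_nat _

theorem pi01Hard_derivabilityProblem : Pi01Hard DerivabilityProblem := by
  intro S hS
  obtain ⟨c, hc⟩ := exists_code_of_rePred hS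
  obtain ⟨k, e, he⟩ := exists_equiv_fin_symm_zero
    (TM2to1.Γ' PartrecToTM2.K' (fun _ => PartrecToTM2.Γ'))
  obtain ⟨Q, hQ, N, hN⟩ := exists_machine_of_code c he
  obtain ⟨ν, hν⟩ := exists_injective_symb Q
  refine ⟨fun n => (Formula.star (formulaE ν N) :: stateVar ν N.start ::
    List.replicate (TMSim.code e (TM2to1.trInit PartrecToTM2.K'.main (PartrecToTM2.trList [n])))
      (counterVar ν .a), formulaD ν N), ?_, fun n => ?_⟩
  · exact ((Primrec.list_cons.comp (Primrec.const _) (Primrec.list_cons.comp (Primrec.const _)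
      ((primrec_replicate _).comp (primrec_code_trInit e)))).pair (Primrec.const _)).to_comp
  · rw [← not_not (a := S n), ← hc, ← hN, runsForever_iff_derivable hν]
    simp only [DerivabilityProblem]
    rw [← Multiset.cons_coe, ← Multiset.cons_coe, Multiset.coe_replicate,
      ← Multiset.singleton_add, ← Multiset.singleton_add, ← add_assoc]

end CommACT

theorem mainTheorem2 :
    (∀ (Q : Type*) (M : CommACT.Machine Q) (ν : CommACT.Symb Q → ℕ), Function.Injective ν →
      ∀ x : ℕ, M.RunsForever x ↔
        CommACT.Derivable
          ({CommACT.Formula.star (CommACT.formulaE ν M)} + {CommACT.stateVar ν M.start} +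
            Multiset.replicate x (CommACT.counterVar ν .a))
          (CommACT.formulaD ν M)) ∧
    CommACT.Pi01Hard CommACT.DerivabilityProblem :=
  ⟨fun _ _ _ hν x => CommACT.runsForever_iff_derivable hν x, CommACT.pi01Hard_derivabilityProblem⟩
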